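/- \textbf{Conventions.} Letters are taken from a fixed countable supply; an alphabet is a finite set of letters, and every language is a language over some alphabet. A class of languages $\mathcal{C}$ comes with a representation of its members by natural numbers (codes of grammars, automata, etc.): a set of valid codes, not necessarily decidable, each representing one language, such that $\mathcal{C}$ is the set of represented languages. "Computable" means computable by a partial recursive function that halts on every valid input with a correct output. A finite-state transducer $(Q,X,Y,E,q_0,F)$ has a finite set $E\subseteq Q\times X^*\times Y^*\times Q$ of edges and generates the transduction $T\subseteq X^*\times Y^*$ of all pairs $(u,v)$ such that some path from $q_0$ to a state in $F$ reads $u$ and outputs $v$; for $L\subseteq X^*$, let $TL=\{v\in Y^*\mid \exists u\in L\colon (u,v)\in T\}$. The class $\mathcal{C}$ is a \emph{full trio} if it is effectively closed under rational transductions, i.e. given a representation of $L\in\mathcal{C}$, $L\subseteq X^*$, and a finite-state transducer with input alphabet $X$ that generates $T$, one can compute a representation of $TL$ in $\mathcal{C}$. The downward closure of a language $L$ is the set of all (scattered) subwords of words in $L$. Downward closures are \emph{computable for} $\mathcal{C}$ if, given a representation of a language $L\in\mathcal{C}$, one can compute a finite automaton that accepts the downward closure of $L$. Languages $L$ and $K$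 are \emph{Parikh-equivalent} if $\{\Psi(w)\mid w\in L\}=\{\Psi(w)\mid w\in K\}$, where $\Psi(w)$ maps each letter $x$ to the number of occurrences of $x$ in $w$. \textbf{Corollary.} Let $\mathcal{C}$ and $\mathcal{D}$ be full trios such that, given a representation of a language $L\in\mathcal{C}$, one can compute a representation of a language $K\in\mathcal{D}$ that is Parikh-equivalent to $L$. If downward closures are computable for $\mathcal{D}$, then they are computable for $\mathcal{C}$. -/

import Mathlib

namespace DClosure

/-! Letters are natural numbers; an alphabet is a finite set (or list) of letters; words are
lists of letters; languages are Mathlib's `Language ℕ`. -/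

/-- `L ⊆ X*`, where `X` is the set of letters listed in `X`. -/
def IsOver (L : Language ℕ) (X : List ℕ) : Prop :=
  ∀ w ∈ L, ∀ x ∈ w, x ∈ X

/-- The set of all (scattered) subwords of words in `L`. -/
def downwardClosure (L : Language ℕ) : Language ℕ :=
  {u | ∃ v ∈ L, u.Sublist v}

/-- The Parikh map: `parikh w x` is the number of occurrences of `x` in `w`. -/
def parikh (w : List ℕ) : ℕ → ℕ :=
  fun x => w.count x

/-- The Parikh image of a language. -/
def parikhImage (L : Language ℕ) : Set (ℕ → ℕ) :=
  {α | ∃ w ∈ L, parikh w = α}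

def ParikhEquivalent (L K : Language ℕ) : Prop :=
  parikhImage L = parikhImage K

/-- A finite automaton `(Q, X, E, q₀, F)` with edges in `Q × X* × Q`. States are natural numbers;
`Q` is the finite set of the states that occur in the other components. -/
structure FiniteAutomaton where
  alphabet : List ℕ
  edges : List (ℕ × List ℕ × ℕ)
  start : ℕ
  final : List ℕ

namespace FiniteAutomaton

/-- All edge labels are words over the input alphabet. -/
def WellFormed (A : FiniteAutomaton) : Prop :=
  ∀ p u q, (p, u, q) ∈ A.edges → ∀ x ∈ u, x ∈ A.alphabet

/-- `A.Path p w q`: there is a path from `p` to `q` labelled `w`. -/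
inductive Path (A : FiniteAutomaton) : ℕ → List ℕ → ℕ → Prop
  | nil (q : ℕ) : Path A q [] q
  | cons {p q r : ℕ} {u w : List ℕ} :
      (p, u, q) ∈ A.edges → Path A q w r → Path A p (u ++ w) r

/-- The language accepted by `A`. -/
def accepts (A : FiniteAutomaton) : Language ℕ :=
  {w | ∃ q ∈ A.final, A.Path A.start w q}

/-- The components of an automaton, as a tuple. -/
def equivTuple : FiniteAutomaton ≃ List ℕ × List (ℕ × List ℕ × ℕ) × ℕ × List ℕ where
  toFun A := (A.alphabet, A.edges, A.start, A.final)
  invFun t := ⟨t.1, t.2.1, t.2.2.1, t.2.2.2⟩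
  left_inv _ := rfl
  right_inv _ := rfl

/-- The standard encoding of the tuple. -/
instance : Primcodable FiniteAutomaton := Primcodable.ofEquiv _ equivTuple

end FiniteAutomaton

/-- A finite-state transducer `(Q, X, Y, E, q₀, F)` with edges in `Q × X* × Y* × Q`. States are
natural numbers; `Q` is the finite set of the states that occur in the other components. -/
structure Transducer where
  input : List ℕ
  output : List ℕ
  edges : List (ℕ × List ℕ × List ℕ × ℕ)
  start : ℕ
  final : List ℕ

namespace Transducer

/-- All edges read words over the input alphabet and write words over the output alphabet. -/
def WellFormed (T : Transducer) : Prop :=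
  ∀ p u v q, (p, u, v, q) ∈ T.edges → (∀ x ∈ u, x ∈ T.input) ∧ (∀ y ∈ v, y ∈ T.output)

/-- `T.Path p u v q`: there is a path from `p` to `q` that reads `u` and writes `v`. -/
inductive Path (T : Transducer) : ℕ → List ℕ → List ℕ → ℕ → Prop
  | nil (q : ℕ) : Path T q [] [] q
  | cons {p q r : ℕ} {u v u' v' : List ℕ} :
      (p, u, v, q) ∈ T.edges → Path T q u' v' r → Path T p (u ++ u') (v ++ v') r

/-- The rational transduction generated by `T`. -/
def transduction (T : Transducer) : Set (List ℕ × List ℕ) :=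
  {p | ∃ q ∈ T.final, T.Path T.start p.1 p.2 q}

/-- The image of `L` under the transduction generated by `T`. -/
def apply (T : Transducer) (L : Language ℕ) : Language ℕ :=
  {v | ∃ u ∈ L, (u, v) ∈ T.transduction}

/-- The components of a transducer, as a tuple. -/
def equivTuple : Transducer ≃
    List ℕ × List ℕ × List (ℕ × List ℕ × List ℕ × ℕ) × ℕ × List ℕ where
  toFun T := (T.input, T.output, T.edges, T.start, T.final)
  invFun t := ⟨t.1, t.2.1, t.2.2.1, t.2.2.2.1, t.2.2.2.2⟩
  left_inv _ := rfl
  right_inv _ := rfl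

/-- The standard encoding of the tuple. -/
instance : Primcodable Transducer := Primcodable.ofEquiv _ equivTuple

end Transducer

/-- A class of languages together with a way to represent its members by natural numbers (codes of
grammars, automata, ...): `reps` is the set of valid representations, which need not be
decidable, and `lang c` is the language represented by `c ∈ reps` (its value at other numbers is
irrelevant). A language in the class is a language over some finite alphabet; a language may
have many representations. -/
structure LanguageClass where
  reps : Set ℕ
  lang : ℕ → Language ℕ
  exists_alphabet : ∀ c ∈ reps, ∃ X : List ℕ, IsOver (lang c) X

namespace LanguageClass

/-- Effective closure under rational transductions: an algorithm turns a representation of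
`L ⊆ X*` and a transducer with input alphabet `X` into a representation of the image of `L`.
An algorithm is a partial recursive function that has to halt on all valid inputs. -/
def IsFullTrio (C : LanguageClass) : Prop :=
  ∃ f : ℕ × Transducer →. ℕ, Partrec f ∧
    ∀ c ∈ C.reps, ∀ T : Transducer, T.WellFormed → IsOver (C.lang c) T.input →
      ∃ d ∈ f (c, T), d ∈ C.reps ∧ C.lang d = T.apply (C.lang c)

/-- An algorithm turns each representation of a language `L` in `C` into a finite automaton
for the downward closure of `L`. -/
def DownwardClosuresComputable (C : LanguageClass) : Prop :=
  ∃ f : ℕ →. FiniteAutomaton, Partrec f ∧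
    ∀ c ∈ C.reps, ∃ A ∈ f c, A.WellFormed ∧ A.accepts = downwardClosure (C.lang c)

/-- An algorithm turns each representation of a language `L` in `C` into a representation of a
language in `D` that is Parikh-equivalent to `L`. -/
def ParikhEquivalentsComputable (C D : LanguageClass) : Prop :=
  ∃ f : ℕ →. ℕ, Partrec f ∧
    ∀ c ∈ C.reps, ∃ d ∈ f c, d ∈ D.reps ∧ ParikhEquivalent (C.lang c) (D.lang d)

end LanguageClass

end DClosure

/-! Let `M` be the downward closure of `L`. It lies in the class `C`, because taking subwords is a
rational transduction. Parikh equivalence transfers information about letter counts from `D` to `C`: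
for a rational image `T M`, an automaton for the downward closure of a Parikh-equivalent language in
`D` shows whether `T M` is empty and whether given letters are simultaneously unbounded in it
(`LanguageClass.semiDec_apply`). The order of letters is lost, so the transducer `T` has to take
care of it.

An automaton for `M` is found by guessing and checking. A candidate is a finite tree whose branches
denote u₀Y₀*u₁Y₁*...uₙYₙ* with finite sets Yᵢ of letters. List Yᵢ as a word vᵢ. Since `M` is
downward closed, such a set lies in `M` as soon as `M` contains words u₀v₀^k₀...uₙvₙ^kₙ with all kᵢ
arbitrarily large at once. A transducer that writes the letter i at each iteration of block i turns
this into simultaneous unboundedness. That no word of `M` is missed is a matter of emptiness: a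
letter without an edge at a node must lead out of `M`. These conditions force equality
(`IsTree.accepts_eq`) and are semidecidable (`semiDec_isTree`), so an unbounded search finds a
correct candidate if there is one.

There is one by Higman's lemma (`exists_isTree`). The quotients of `M` shrink weakly with every
letter read and cannot shrink strictly forever. The nodes are the words in `M` each of whose letters
shrinks the quotient strictly; the letters that preserve the quotient become loops. -/

namespace DClosure

/-! ### Semidecidable predicates -/

section SemiDec

variable {α β σ : Type*} [Primcodable α] [Primcodable β] [Primcodable σ]

/-- A predicate is semidecidable if it is the projection of a primitive recursive relation. -/
def SemiDec (p : α → Prop) : Prop :=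
  ∃ R : α → ℕ → Prop, PrimrecRel R ∧ ∀ a, p a ↔ ∃ m, R a m

namespace SemiDec

theorem of_primrecPred {p : α → Prop} (hp : PrimrecPred p) : SemiDec p :=
  ⟨fun a _ => p a, hp.comp Primrec.fst, fun _ => by simp⟩

theorem of_iff {p q : α → Prop} (hp : SemiDec p) (h : ∀ a, q a ↔ p a) : SemiDec q := by
  obtain ⟨R, hR, hp⟩ := hp
  exact ⟨R, hR, fun a => (h a).trans (hp a)⟩

theorem comp {p : β → Prop} (hp : SemiDec p) {f : α → β} (hf : Primrec f) :
    SemiDec fun a => p (f a) := by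
  obtain ⟨R, hR, hp⟩ := hp
  exact ⟨fun a m => R (f a) m, hR.comp (hf.comp Primrec.fst) Primrec.snd, fun a => hp (f a)⟩

theorem and {p q : α → Prop} (hp : SemiDec p) (hq : SemiDec q) :
    SemiDec fun a => p a ∧ q a := by
  obtain ⟨R, hR, hp⟩ := hp
  obtain ⟨S, hS, hq⟩ := hq
  refine ⟨fun a m => R a m.unpair.1 ∧ S a m.unpair.2, ?_, fun a => ?_⟩
  · exact (hR.comp Primrec.fst (Primrec.fst.comp (Primrec.unpair.comp Primrec.snd))).and
      (hS.comp Primrec.fst (Primrec.snd.comp (Primrec.unpair.comp Primrec.snd)))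
  · simp only [hp, hq]
    constructor
    · rintro ⟨⟨m, hm⟩, n, hn⟩
      exact ⟨Nat.pair m n, by simpa using ⟨hm, hn⟩⟩
    · rintro ⟨m, h1, h2⟩
      exact ⟨⟨_, h1⟩, _, h2⟩

theorem or {p q : α → Prop} (hp : SemiDec p) (hq : SemiDec q) :
    SemiDec fun a => p a ∨ q a := by
  obtain ⟨R, hR, hp⟩ := hp
  obtain ⟨S, hS, hq⟩ := hq
  refine ⟨fun a m => R a m ∨ S a m, PrimrecPred.or hR hS, fun a => ?_⟩
  simp only [hp, hq, exists_or]

theorem exists_right {p : α × β → Prop} (hp : SemiDec p) : SemiDec fun a => ∃ b, p (a, b) := by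
  classical
  obtain ⟨R, hR, hp⟩ := hp
  -- The number `m` codes a pair: a code of `b` and a witness for `p (a, b)`.
  refine ⟨fun a m => ((Encodable.decode (α := β) m.unpair.1).map
      fun b => decide (R (a, b) m.unpair.2)) = some true, ?_, fun a => ?_⟩
  · have h1 : Primrec fun t : α × ℕ => (Encodable.decode (α := β) t.2.unpair.1) :=
      Primrec.decode.comp (Primrec.fst.comp (Primrec.unpair.comp Primrec.snd))
    have h2 : Primrec₂ fun (t : α × ℕ) (b : β) => decide (R (t.1, b) t.2.unpair.2) := by
      exact hR.decide.comp (Primrec.pair (Primrec.fst.comp Primrec.fst) Primrec.snd)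
        (Primrec.snd.comp (Primrec.unpair.comp (Primrec.snd.comp Primrec.fst)))
    exact Primrec.eq.comp (Primrec.option_map h1 h2) (Primrec.const _)
  · constructor
    · rintro ⟨b, hb⟩
      obtain ⟨m, hm⟩ := (hp _).1 hb
      exact ⟨Nat.pair (Encodable.encode b) m, by simpa using hm⟩
    · rintro ⟨m, hm⟩
      simp only [Option.map_eq_some_iff, decide_eq_true_eq] at hm
      obtain ⟨b, -, hb⟩ := hm
      exact ⟨b, (hp _).2 ⟨_, hb⟩⟩

theorem forall_mem_right {p : α × β → Prop} (hp : SemiDec p) :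
    SemiDec fun a : α × List β => ∀ b ∈ a.2, p (a.1, b) := by
  obtain ⟨R, hR, hp⟩ := hp
  -- Finitely many witnesses have a common bound `M`, and search below `M` is primitive recursive.
  refine ⟨fun a M => ∀ b ∈ a.2, ∃ m < M, R (a.1, b) m, ?_, fun a => ?_⟩
  · have h1 : PrimrecRel (α := ℕ) (β := α × β) fun (m : ℕ) (t : α × β) => R t m := PrimrecRel.swap hR
    have h2 : PrimrecRel (α := β) (β := α × ℕ) fun b t => ∃ m ∈ List.range t.2, R (t.1, b) m :=
      h1.exists_mem_list.comp (Primrec.list_range.comp (Primrec.snd.comp Primrec.snd))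
        (Primrec.pair (Primrec.fst.comp Primrec.snd) Primrec.fst)
    simp only [List.mem_range] at h2
    exact h2.forall_mem_list.comp (Primrec.snd.comp Primrec.fst)
      (Primrec.pair (Primrec.fst.comp Primrec.fst) Primrec.snd)
  · constructor
    · intro h
      choose! f hf using fun b hb => (hp (a.1, b)).1 (h b hb)
      have : ∃ M, ∀ b ∈ a.2, f b < M := by
        obtain ⟨M, hM⟩ := (a.2.finite_toSet.image f).bddAbove
        exact ⟨M + 1, fun b hb => Nat.lt_succ_of_le (hM ⟨b, hb, rfl⟩)⟩
      obtain ⟨M, hM⟩ := this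
      exact ⟨M, fun b hb => ⟨f b, hM b hb, hf b hb⟩⟩
    · rintro ⟨M, hM⟩ b hb
      obtain ⟨m, -, hm⟩ := hM b hb
      exact (hp _).2 ⟨m, hm⟩

/-- Evaluation with a step bound is primitive recursive and finds every value of `f` under some
bound. -/
theorem graph {f : α →. β} (hf : Partrec f) : SemiDec fun t : α × β => t.2 ∈ f t.1 := by
  obtain ⟨c, hc⟩ := Nat.Partrec.Code.exists_code.1 hf
  refine ⟨fun t k => c.evaln k (Encodable.encode t.1) = some (Encodable.encode t.2), ?_,
    fun t => ?_⟩
  · refine Primrec.eq.comp (Nat.Partrec.Code.primrec_evaln.comp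
      (Primrec.pair (Primrec.pair Primrec.snd (Primrec.const c))
        (Primrec.encode.comp (Primrec.fst.comp Primrec.fst)))) ?_
    exact Primrec.option_some.comp (Primrec.encode.comp (Primrec.snd.comp Primrec.fst))
  · have := Nat.Partrec.Code.evaln_complete (c := c) (n := Encodable.encode t.1)
      (x := Encodable.encode t.2)
    rw [hc] at this
    simpa using this

/-- Search for a witness. -/
theorem uniformize {p : α × β → Prop} (hp : SemiDec p) :
    ∃ f : α →. β, Partrec f ∧ ∀ a, (∃ b, p (a, b)) → ∃ b ∈ f a, p (a, b) := by
  classical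
  obtain ⟨R, hR, hp⟩ := hp
  let g : α → ℕ → Option β := fun a m => (Encodable.decode (α := β) m.unpair.1).bind
    fun b => bif decide (R (a, b) m.unpair.2) then some b else none
  have hg : Primrec₂ g := by
    refine Primrec.option_bind (Primrec.decode.comp
      (Primrec.fst.comp (Primrec.unpair.comp Primrec.snd))) ?_
    exact Primrec.cond (hR.decide.comp
        (Primrec.pair (Primrec.fst.comp Primrec.fst) Primrec.snd)
        (Primrec.snd.comp (Primrec.unpair.comp (Primrec.snd.comp Primrec.fst))))
      (Primrec.option_some.comp Primrec.snd) (Primrec.const _)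
  have hgp : ∀ a m b, b ∈ g a m → p (a, b) := by
    intro a m b h
    simp only [g, Option.mem_def, Option.bind_eq_some_iff] at h
    obtain ⟨b', -, h⟩ := h
    by_cases hr : R (a, b') m.unpair.2 <;> simp [hr] at h
    subst h
    exact (hp _).2 ⟨_, hr⟩
  refine ⟨fun a => Nat.rfindOpt (g a), Partrec.rfindOpt hg.to_comp, ?_⟩
  rintro a ⟨b, hb⟩
  obtain ⟨m, hm⟩ := (hp _).1 hb
  have hd : (Nat.rfindOpt (g a)).Dom := by
    refine Nat.rfindOpt_dom.2 ⟨Nat.pair (Encodable.encode b) m, b, ?_⟩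
    simp [g, hm]
  obtain ⟨n, hn⟩ := Nat.rfindOpt_spec (Part.get_mem hd)
  exact ⟨_, Part.get_mem hd, hgp _ _ _ hn⟩

end SemiDec

theorem primrecRel_mem : PrimrecRel fun (x : α) (l : List α) => x ∈ l :=
  (Primrec.eq.exists_mem_list.swap).of_eq fun x l => by simp

end SemiDec

/-! ### Emptiness and simultaneous unboundedness for finite automata -/

/-- There are words in `M` with arbitrarily many occurrences of all letters in `l`. -/
def SimultaneouslyUnbounded (M : Language ℕ) (l : List ℕ) : Prop :=
  ∀ k, ∃ w ∈ M, ∀ a ∈ l, k ≤ w.count a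

namespace FiniteAutomaton

theorem primrec_tuple : Primrec equivTuple := Primrec.of_equiv

theorem primrec_alphabet : Primrec FiniteAutomaton.alphabet :=
  Primrec.fst.comp primrec_tuple

theorem primrec_edges : Primrec FiniteAutomaton.edges :=
  Primrec.fst.comp (Primrec.snd.comp primrec_tuple)

theorem primrec_start : Primrec FiniteAutomaton.start :=
  Primrec.fst.comp (Primrec.snd.comp (Primrec.snd.comp primrec_tuple))

theorem primrec_final : Primrec FiniteAutomaton.final :=
  Primrec.snd.comp (Primrec.snd.comp (Primrec.snd.comp primrec_tuple))

variable {A : FiniteAutomaton}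

theorem Path.snoc {p q r : ℕ} {w u : List ℕ} (h : A.Path p w q) (e : (q, u, r) ∈ A.edges) :
    A.Path p (w ++ u) r := by
  induction h with
  | nil q => simpa using Path.cons e (Path.nil r)
  | cons e' _ ih => rw [List.append_assoc]; exact Path.cons e' (ih e)

theorem Path.invariant {I : ℕ → List ℕ → Prop}
    (step : ∀ p w u q, I p w → (p, u, q) ∈ A.edges → I q (w ++ u))
    {p q : ℕ} {w : List ℕ} (h : A.Path p w q) : ∀ v, I p v → I q (v ++ w) := by
  induction h with
  | nil q => intro v hv; simpa using hv
  | cons e _ ih => intro v hv; rw [← List.append_assoc]; exact ih _ (step _ _ _ _ hv e)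

/-- Emptiness is certified by a list of states that contains the start, is closed under edges and
avoids the final states. -/
theorem semiDec_forall_notMem_accepts : SemiDec fun A : FiniteAutomaton => ∀ w, w ∉ A.accepts := by
  have key : SemiDec fun t : FiniteAutomaton × List ℕ =>
      t.1.start ∈ t.2 ∧ (∀ e ∈ t.1.edges, e.1 ∉ t.2 ∨ e.2.2 ∈ t.2) ∧ ∀ q ∈ t.1.final, q ∉ t.2 := by
    apply SemiDec.of_primrecPred
    refine PrimrecPred.and ?_ (PrimrecPred.and ?_ ?_)
    · exact primrecRel_mem.comp (primrec_start.comp Primrec.fst) Primrec.snd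
    · have : PrimrecRel fun (e : ℕ × List ℕ × ℕ) (l : List ℕ) => e.1 ∉ l ∨ e.2.2 ∈ l :=
        PrimrecPred.or (PrimrecPred.not (primrecRel_mem.comp (Primrec.fst.comp Primrec.fst) Primrec.snd))
          (primrecRel_mem.comp (Primrec.snd.comp (Primrec.snd.comp Primrec.fst)) Primrec.snd)
      exact this.forall_mem_list.comp (primrec_edges.comp Primrec.fst) Primrec.snd
    · exact primrecRel_mem.not.forall_mem_list.comp (primrec_final.comp Primrec.fst) Primrec.snd
  refine key.exists_right.of_iff fun A => ?_
  constructor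
  · intro h
    classical
    -- The certificate is the set of reachable states; all of them are the start or targets of
    -- edges, so they form a list.
    refine ⟨(A.start :: A.edges.map fun e => e.2.2).filter
      fun q => decide (∃ w, A.Path A.start w q), ?_, ?_, ?_⟩
    · simpa using ⟨[], Path.nil _⟩
    · intro e he
      rw [or_iff_not_imp_left, not_not]
      intro h1
      simp only [List.mem_filter, decide_eq_true_eq] at h1 ⊢
      obtain ⟨-, w, hw⟩ := h1
      exact ⟨List.mem_cons_of_mem _ (List.mem_map.2 ⟨e, he, rfl⟩), _, hw.snoc (u := e.2.1) he⟩
    · intro q hq h1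
      simp only [List.mem_filter, decide_eq_true_eq] at h1
      obtain ⟨-, w, hw⟩ := h1
      have : w ∈ A.accepts := ⟨q, hq, hw⟩
      exact h w this
  · rintro ⟨S, h1, h2, h3⟩
    rintro w ⟨q, hq, hw⟩
    refine h3 q hq (Path.invariant (I := fun q _ => q ∈ S) ?_ hw [] h1)
    intro p _ u q hp he
    exact (h2 _ he).resolve_left (not_not.2 hp)

/-- `A.Run p es q`: the edges `es` form a path from `p` to `q`. -/
def Run (A : FiniteAutomaton) : ℕ → List (ℕ × List ℕ × ℕ) → ℕ → Prop
  | p, [], q => p = q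
  | p, e :: es, q => e ∈ A.edges ∧ e.1 = p ∧ A.Run e.2.2 es q

/-- The word read by a sequence of edges. -/
def label (es : List (ℕ × List ℕ × ℕ)) : List ℕ := es.flatMap fun e => e.2.1

theorem path_iff_exists_run {p q : ℕ} {w : List ℕ} :
    A.Path p w q ↔ ∃ es, A.Run p es q ∧ label es = w := by
  constructor
  · intro h
    induction h with
    | nil q => exact ⟨[], rfl, rfl⟩
    | @cons p q r u w e _ ih =>
      obtain ⟨es, h1, h2⟩ := ih
      exact ⟨(p, u, q) :: es, ⟨e, rfl, h1⟩, by simp [label] at h2 ⊢; exact h2⟩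
  · rintro ⟨es, h, rfl⟩
    induction es generalizing p with
    | nil => cases h; exact Path.nil _
    | cons e es ih =>
      obtain ⟨h1, rfl, h3⟩ := h
      simpa [label] using Path.cons h1 (ih h3)

theorem run_append {p q : ℕ} {es fs : List (ℕ × List ℕ × ℕ)} :
    A.Run p (es ++ fs) q ↔ ∃ r, A.Run p es r ∧ A.Run r fs q := by
  induction es generalizing p with
  | nil => simp [Run]
  | cons e es ih => simp [Run, ih, and_assoc]

theorem Run.mem_edges {p q : ℕ} {es : List (ℕ × List ℕ × ℕ)} (h : A.Run p es q) :
    ∀ e ∈ es, e ∈ A.edges := by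
  induction es generalizing p with
  | nil => simp
  | cons e es ih =>
    rintro f (_ | ⟨_, hf⟩)
    · exact h.1
    · exact ih h.2.2 f hf

/-- A letter on an edge that occurs twice in a run can be pumped. -/
theorem Run.pump {p q : ℕ} {es : List (ℕ × List ℕ × ℕ)} (h : A.Run p es q)
    {e : ℕ × List ℕ × ℕ} (he : [e, e].Sublist es) {a : ℕ} (ha : a ∈ e.2.1) (k : ℕ) :
    ∃ fs, A.Run p fs q ∧ es.Sublist fs ∧ k ≤ (label fs).count a := by
  induction k with
  | zero => exact ⟨es, h, List.Sublist.refl _, Nat.zero_le _⟩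
  | succ k ih =>
    obtain ⟨fs, h1, h2, h3⟩ := ih
    obtain ⟨x, y, rfl, hx, hy⟩ := List.cons_sublist_iff.1 (he.trans h2)
    rw [List.singleton_sublist] at hy
    obtain ⟨x1, x2, rfl⟩ := List.append_of_mem hx
    obtain ⟨y1, y2, rfl⟩ := List.append_of_mem hy
    obtain ⟨r, hr1, hr2⟩ := run_append.1 h1
    obtain ⟨s, hs1, hs2⟩ := run_append.1 hr1
    obtain ⟨t, ht1, ht2⟩ := run_append.1 hr2
    obtain rfl := hs2.2.1
    have ht : e.1 = t := ht2.2.1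
    subst ht
    have loop : A.Run e.1 ((e :: x2) ++ y1) e.1 := run_append.2 ⟨r, hs2, ht1⟩
    -- The segment from the first `e` up to just before the second one is a cycle. Inserting it once
    -- more adds at least one `a` and keeps the old run as a subsequence.
    refine ⟨x1 ++ ((e :: x2) ++ y1) ++ ((e :: x2) ++ (y1 ++ e :: y2)), ?_, ?_, ?_⟩
    · exact run_append.2 ⟨_, run_append.2 ⟨_, hs1, loop⟩,
        run_append.2 ⟨_, hs2, run_append.2 ⟨_, ht1, ht2⟩⟩⟩
    · refine h2.trans ?_
      rw [List.append_assoc, List.append_assoc]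
      exact (List.Sublist.refl _).append (List.sublist_append_right _ _)
    · have := List.count_pos_iff.2 ha
      simp only [label, List.flatMap_append, List.flatMap_cons, List.count_append] at h3 ⊢
      omega

/-- The letters can be pumped one after another: each pumping keeps the earlier run as a
subsequence, hence also its repeated edges and the counts reached so far. -/
theorem Run.pump_all {p q : ℕ} {es : List (ℕ × List ℕ × ℕ)} (h : A.Run p es q) (l : List ℕ)
    (hl : ∀ a ∈ l, ∃ e, [e, e].Sublist es ∧ a ∈ e.2.1) (k : ℕ) :
    ∃ fs, A.Run p fs q ∧ es.Sublist fs ∧ ∀ a ∈ l, k ≤ (label fs).count a := by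
  induction l with
  | nil => exact ⟨es, h, List.Sublist.refl _, by simp⟩
  | cons a l ih =>
    obtain ⟨fs, h1, h2, h3⟩ := ih fun a ha => hl a (List.mem_cons_of_mem _ ha)
    obtain ⟨e, he, ha⟩ := hl a List.mem_cons_self
    obtain ⟨gs, g1, g2, g3⟩ := h1.pump (he.trans h2) ha k
    refine ⟨gs, g1, h2.trans g2, ?_⟩
    intro b hb
    rcases List.mem_cons.1 hb with rfl | hb
    · exact g3
    · exact (h3 b hb).trans ((g2.flatMap _).count_le _)

/-- Pigeonhole: if every edge whose label contains `a` is used at most once, then `a` is read at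
most as often as there are letters on all edges in `E`. -/
theorem exists_repeated_edge {E es : List (ℕ × List ℕ × ℕ)} (hes : ∀ e ∈ es, e ∈ E) {a : ℕ}
    (h : (label E).length < (label es).count a) :
    ∃ e, [e, e].Sublist es ∧ a ∈ e.2.1 := by
  by_contra! hc
  have h1 : (es.filter fun e => decide (a ∈ e.2.1)).Nodup := by
    rw [List.nodup_iff_sublist]
    intro e he
    have h2 : e ∈ es.filter fun e => decide (a ∈ e.2.1) := he.subset List.mem_cons_self
    exact hc e (he.trans List.filter_sublist) (by simpa using (List.mem_filter.1 h2).2)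
  have h2 : (es.filter fun e => decide (a ∈ e.2.1)).Subperm E :=
    h1.subperm fun e he => hes e (List.mem_filter.1 he).1
  have h3 : ∀ es : List (ℕ × List ℕ × ℕ),
      (label es).count a = (label (es.filter fun e => decide (a ∈ e.2.1))).count a := by
    intro es
    induction es with
    | nil => rfl
    | cons e es ih =>
      by_cases ha : a ∈ e.2.1
      · simp [label, ha] at ih ⊢; omega
      · simp [label, ha, List.count_eq_zero_of_not_mem ha] at ih ⊢; omega
  obtain ⟨l, hl1, hl2⟩ := h2
  have h4 : (label (es.filter fun e => decide (a ∈ e.2.1))).length ≤ (label E).length := by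
    have := (hl1.flatMap_right (fun e : ℕ × List ℕ × ℕ => e.2.1)).length_eq
    have h5 := (hl2.flatMap (fun e : ℕ × List ℕ × ℕ => e.2.1)).length_le
    simp only [label] at *
    omega
  have h5 := List.count_le_length (a := a) (l := label (es.filter fun e => decide (a ∈ e.2.1)))
  rw [h3] at h
  omega

/-- This replaces the quantifier over all `k` by one finite certificate: a single accepting run that
repeats an edge for each letter. -/
theorem simultaneouslyUnbounded_accepts_iff (l : List ℕ) :
    SimultaneouslyUnbounded A.accepts l ↔
      ∃ es, ∃ q ∈ A.final, A.Run A.start es q ∧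
        ∀ a ∈ l, ∃ e, [e, e].Sublist es ∧ a ∈ e.2.1 := by
  constructor
  · intro h
    obtain ⟨w, ⟨q, hq, hw⟩, hl⟩ := h ((label A.edges).length + 1)
    obtain ⟨es, hes, rfl⟩ := path_iff_exists_run.1 hw
    exact ⟨es, q, hq, hes, fun a ha => exists_repeated_edge hes.mem_edges (hl a ha)⟩
  · rintro ⟨es, q, hq, hes, hl⟩ k
    obtain ⟨fs, h1, -, h3⟩ := hes.pump_all l hl k
    exact ⟨_, ⟨q, hq, path_iff_exists_run.2 ⟨fs, h1, rfl⟩⟩, h3⟩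

/-- The state reached by a sequence of edges. -/
def follow (E es : List (ℕ × List ℕ × ℕ)) (p : ℕ) : Option ℕ :=
  es.foldl (fun o e => if e ∈ E ∧ o = some e.1 then some e.2.2 else none) (some p)

/-- A sequence of edges determines its end state, so checking a run is a fold and thus primitive
recursive. -/
theorem run_iff_follow {p q : ℕ} {es : List (ℕ × List ℕ × ℕ)} :
    A.Run p es q ↔ follow A.edges es p = some q := by
  have hnone : ∀ es : List (ℕ × List ℕ × ℕ), es.foldl (fun (o : Option ℕ) e =>
      if e ∈ A.edges ∧ o = some e.1 then some e.2.2 else none) none = none := by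
    intro es; induction es <;> simp_all
  induction es generalizing p with
  | nil => simp [Run, follow]
  | cons e es ih =>
    simp only [Run, follow, List.foldl_cons, ih]
    by_cases h : e ∈ A.edges ∧ some p = some e.1
    · rw [if_pos h]
      simp [h.1, (Option.some_injective _ h.2)]
    · rw [if_neg h, hnone]
      simp only [Option.some.injEq] at h
      simp only [reduceCtorEq, iff_false]
      exact fun h' => h ⟨h'.1, h'.2.1.symm⟩

theorem semiDec_simultaneouslyUnbounded :
    SemiDec fun t : FiniteAutomaton × List ℕ => SimultaneouslyUnbounded t.1.accepts t.2 := by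
  have h1 : SemiDec fun t : List (ℕ × List ℕ × ℕ) × ℕ =>
      ∃ e, [e, e].Sublist t.1 ∧ t.2 ∈ e.2.1 := by
    have h : SemiDec fun t : (List (ℕ × List ℕ × ℕ) × ℕ) × (ℕ × List ℕ × ℕ) ×
        List (ℕ × List ℕ × ℕ) × List (ℕ × List ℕ × ℕ) =>
        t.1.1 = t.2.2.1 ++ t.2.2.2 ∧ t.2.1 ∈ t.2.2.1 ∧ t.2.1 ∈ t.2.2.2 ∧ t.1.2 ∈ t.2.1.2.1 := by
      have p1 := Primrec.fst (α := List (ℕ × List ℕ × ℕ) × ℕ) (β := (ℕ × List ℕ × ℕ) ×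
        List (ℕ × List ℕ × ℕ) × List (ℕ × List ℕ × ℕ))
      have p2 := Primrec.snd (α := List (ℕ × List ℕ × ℕ) × ℕ) (β := (ℕ × List ℕ × ℕ) ×
        List (ℕ × List ℕ × ℕ) × List (ℕ × List ℕ × ℕ))
      have p21 := Primrec.fst.comp p2
      have p221 := Primrec.fst.comp (Primrec.snd.comp p2)
      have p222 := Primrec.snd.comp (Primrec.snd.comp p2)
      apply SemiDec.of_primrecPred
      exact (Primrec.eq.comp (Primrec.fst.comp p1) (Primrec.list_append.comp p221 p222)).and
        ((primrecRel_mem.comp p21 p221).and ((primrecRel_mem.comp p21 p222).and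
        (primrecRel_mem.comp (Primrec.snd.comp p1) (Primrec.fst.comp (Primrec.snd.comp p21)))))
    refine h.exists_right.of_iff fun t => ?_
    simp only [List.cons_sublist_iff, Prod.exists]
    constructor
    · rintro ⟨e₁, e₂, e₃, ⟨x, y, h1, h2, z, _, rfl, h3, -⟩, h4⟩
      exact ⟨e₁, e₂, e₃, x, _, h1, h2, List.mem_append_left _ h3, h4⟩
    · rintro ⟨e₁, e₂, e₃, x, y, h1, h2, h3, h4⟩
      exact ⟨e₁, e₂, e₃, ⟨x, y, h1, h2, y, [], by simp, h3, by simp⟩, h4⟩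
  have h2 : SemiDec fun t : (FiniteAutomaton × List ℕ) × List (ℕ × List ℕ × ℕ) =>
      ∃ q ∈ t.1.1.final, t.1.1.Run t.1.1.start t.2 q := by
    have p1 := Primrec.fst.comp
      (Primrec.fst (α := FiniteAutomaton × List ℕ) (β := List (ℕ × List ℕ × ℕ)))
    have hf : Primrec fun t : (FiniteAutomaton × List ℕ) × List (ℕ × List ℕ × ℕ) =>
        follow t.1.1.edges t.2 t.1.1.start := by
      refine Primrec.list_foldl (h := fun t s => if s.2 ∈ t.1.1.edges ∧ s.1 = some s.2.1
        then some s.2.2.2 else none) Primrec.snd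
        (Primrec.option_some.comp (primrec_start.comp p1)) ?_
      refine Primrec.ite (PrimrecPred.and ?_ ?_) ?_ (Primrec.const _)
      · exact primrecRel_mem.comp (Primrec.snd.comp Primrec.snd)
          (primrec_edges.comp (p1.comp Primrec.fst))
      · exact Primrec.eq.comp (Primrec.fst.comp Primrec.snd)
          (Primrec.option_some.comp (Primrec.fst.comp (Primrec.snd.comp Primrec.snd)))
      · exact Primrec.option_some.comp
          (Primrec.snd.comp (Primrec.snd.comp (Primrec.snd.comp Primrec.snd)))
    have hr : PrimrecRel fun (q : ℕ) (o : Option ℕ) => o = some q :=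
      Primrec.eq.comp Primrec.snd (Primrec.option_some.comp Primrec.fst)
    refine (SemiDec.of_primrecPred
      (hr.exists_mem_list.comp (primrec_final.comp p1) hf)).of_iff fun t => ?_
    simp only [run_iff_follow]
  refine (h2.and (h1.forall_mem_right.comp (Primrec.pair Primrec.snd
    (Primrec.snd.comp Primrec.fst)))).exists_right.of_iff fun t => ?_
  rw [simultaneouslyUnbounded_accepts_iff]
  constructor
  · rintro ⟨es, q, h1, h2, h3⟩
    exact ⟨es, ⟨q, h1, h2⟩, h3⟩
  · rintro ⟨es, ⟨q, h1, h2⟩, h3⟩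
    exact ⟨es, q, h1, h2, h3⟩

end FiniteAutomaton

/-! ### Downward closure and Parikh equivalence -/

theorem sublist_closed {L : Language ℕ} {u v : List ℕ} (h : u.Sublist v)
    (hv : v ∈ downwardClosure L) : u ∈ downwardClosure L := by
  obtain ⟨w, hw, hvw⟩ := hv
  exact ⟨w, hw, h.trans hvw⟩

theorem subset_downwardClosure {L : Language ℕ} {w : List ℕ} (h : w ∈ L) :
    w ∈ downwardClosure L := ⟨w, h, List.Sublist.refl _⟩

theorem simultaneouslyUnbounded_downwardClosure {L : Language ℕ} {l : List ℕ} :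
    SimultaneouslyUnbounded (downwardClosure L) l ↔ SimultaneouslyUnbounded L l := by
  constructor
  · intro h k
    obtain ⟨w, ⟨v, hv, hwv⟩, hl⟩ := h k
    exact ⟨v, hv, fun a ha => (hl a ha).trans (hwv.count_le a)⟩
  · intro h k
    obtain ⟨w, hw, hl⟩ := h k
    exact ⟨w, subset_downwardClosure hw, hl⟩

theorem forall_notMem_downwardClosure {L : Language ℕ} :
    (∀ w, w ∉ downwardClosure L) ↔ ∀ w, w ∉ L :=
  ⟨fun h w hw => h w (subset_downwardClosure hw), fun h _ ⟨v, hv, _⟩ => h v hv⟩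

namespace ParikhEquivalent

variable {L K : Language ℕ}

theorem symm (h : ParikhEquivalent L K) : ParikhEquivalent K L := Eq.symm h

theorem exists_count_eq (h : ParikhEquivalent L K) {w : List ℕ} (hw : w ∈ L) :
    ∃ v ∈ K, ∀ a, v.count a = w.count a := by
  have : parikh w ∈ parikhImage K := h ▸ ⟨w, hw, rfl⟩
  obtain ⟨v, hv, h⟩ := this
  exact ⟨v, hv, fun a => congrFun h a⟩

theorem forall_notMem_iff (h : ParikhEquivalent L K) : (∀ w, w ∉ L) ↔ ∀ w, w ∉ K := by
  constructor
  · intro hL w hw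
    obtain ⟨v, hv, -⟩ := h.symm.exists_count_eq hw
    exact hL v hv
  · intro hK w hw
    obtain ⟨v, hv, -⟩ := h.exists_count_eq hw
    exact hK v hv

theorem simultaneouslyUnbounded (h : ParikhEquivalent L K) {l : List ℕ}
    (hL : SimultaneouslyUnbounded L l) : SimultaneouslyUnbounded K l := by
  intro k
  obtain ⟨w, hw, hl⟩ := hL k
  obtain ⟨v, hv, hc⟩ := h.exists_count_eq hw
  exact ⟨v, hv, fun a ha => by rw [hc]; exact hl a ha⟩

end ParikhEquivalent

/-! ### Transducers and the subword transduction -/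

namespace Transducer

theorem Path.snoc {T : Transducer} {p q r : ℕ} {u v u' v' : List ℕ} (h : T.Path p u v q)
    (e : (q, u', v', r) ∈ T.edges) : T.Path p (u ++ u') (v ++ v') r := by
  induction h with
  | nil q => simpa using Path.cons e (Path.nil r)
  | cons e' _ ih => rw [List.append_assoc, List.append_assoc]; exact Path.cons e' (ih e)

theorem Path.invariant {T : Transducer} {I : ℕ → List ℕ → List ℕ → Prop}
    (step : ∀ p u v u' v' q, I p u v → (p, u', v', q) ∈ T.edges → I q (u ++ u') (v ++ v'))
    {p q : ℕ} {u v : List ℕ} (h : T.Path p u v q) :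
    ∀ x y, I p x y → I q (x ++ u) (y ++ v) := by
  induction h with
  | nil q => intro x y hx; simpa using hx
  | cons e _ ih =>
    intro x y hx
    rw [← List.append_assoc, ← List.append_assoc]
    exact ih _ _ (step _ _ _ _ _ _ hx e)

/-- The transducer with the given edges, with an input alphabet that contains `X`. -/
def ofEdges (X : List ℕ) (E : List (ℕ × List ℕ × List ℕ × ℕ)) (s : ℕ) (F : List ℕ) :
    Transducer :=
  ⟨X ++ E.flatMap fun e => e.2.1, E.flatMap fun e => e.2.2.1, E, s, F⟩

/-- No condition on `X` or `E` is needed, since both alphabets of `ofEdges` include the letters on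
the edges. Guessed candidates may therefore use any letters. -/
theorem wellFormed_ofEdges {X : List ℕ} {E : List (ℕ × List ℕ × List ℕ × ℕ)} {s : ℕ}
    {F : List ℕ} : (ofEdges X E s F).WellFormed := by
  intro p u v q he
  exact ⟨fun x hx => List.mem_append_right _ (List.mem_flatMap.2 ⟨_, he, hx⟩),
    fun x hx => List.mem_flatMap.2 ⟨_, he, hx⟩⟩

theorem isOver_ofEdges {L : Language ℕ} {X : List ℕ} {E : List (ℕ × List ℕ × List ℕ × ℕ)}
    {s : ℕ} {F : List ℕ} (h : IsOver L X) : IsOver L (ofEdges X E s F).input :=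
  fun w hw x hx => List.mem_append_left _ (h w hw x hx)

theorem primrec_ofEdges {α : Type*} [Primcodable α] {X : α → List ℕ}
    {E : α → List (ℕ × List ℕ × List ℕ × ℕ)} {s : α → ℕ} {F : α → List ℕ}
    (hX : Primrec X) (hE : Primrec E) (hs : Primrec s) (hF : Primrec F) :
    Primrec fun a => ofEdges (X a) (E a) (s a) (F a) := by
  have h1 : Primrec fun a => (E a).flatMap fun e => e.2.1 :=
    Primrec.list_flatMap hE (Primrec.fst.comp (Primrec.snd.comp Primrec.snd))
  have h2 : Primrec fun a => (E a).flatMap fun e => e.2.2.1 :=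
    Primrec.list_flatMap hE (Primrec.fst.comp (Primrec.snd.comp (Primrec.snd.comp Primrec.snd)))
  have h3 : Primrec equivTuple.symm := Primrec.of_equiv_symm
  exact h3.comp (Primrec.pair (Primrec.list_append.comp hX h1)
    (Primrec.pair h2 (Primrec.pair hE (Primrec.pair hs hF))))

/-- A transducer for the downward closure. -/
def subword (X : List ℕ) : Transducer :=
  ofEdges X (X.flatMap fun x => [(0, [x], [x], 0), (0, [x], [], 0)]) 0 [0]

theorem primrec_subword : Primrec subword := by
  refine primrec_ofEdges Primrec.id (Primrec.list_flatMap Primrec.id ?_) (Primrec.const _)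
    (Primrec.const _)
  have h : Primrec fun t : List ℕ × ℕ => [t.2] :=
    Primrec.list_cons.comp Primrec.snd (Primrec.const [])
  refine Primrec.list_cons.comp ?_ (Primrec.list_cons.comp ?_ (Primrec.const _))
  · exact Primrec.pair (Primrec.const 0) (Primrec.pair h (Primrec.pair h (Primrec.const 0)))
  · exact Primrec.pair (Primrec.const 0) (Primrec.pair h (Primrec.const ([], 0)))

theorem apply_subword {L : Language ℕ} {X : List ℕ} (h : IsOver L X) :
    (subword X).apply L = downwardClosure L := by
  ext v
  constructor
  · rintro ⟨u, hu, q, -, hp⟩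
    refine ⟨u, hu, Path.invariant (I := fun _ u v => v.Sublist u) ?_ hp [] [] (by simp)⟩
    intro p u v u' v' q huv he
    refine huv.append ?_
    simp only [subword, ofEdges, List.mem_flatMap] at he
    obtain ⟨x, -, he⟩ := he
    simp only [List.mem_cons, Prod.mk.injEq, List.not_mem_nil, or_false] at he
    rcases he with ⟨-, rfl, rfl, -⟩ | ⟨-, rfl, rfl, -⟩ <;> simp
  · rintro ⟨u, hu, hvu⟩
    have hX : ∀ x ∈ u, x ∈ X := h u hu
    refine ⟨u, hu, 0, by simp [subword, ofEdges], ?_⟩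
    change (subword X).Path 0 u v 0
    clear hu
    induction hvu with
    | slnil => exact Path.nil _
    | @cons v u x _ ih =>
      refine Path.cons (u := [x]) (v := []) (q := 0) ?_
        (ih fun y hy => hX y (List.mem_cons_of_mem _ hy))
      exact List.mem_flatMap.2 ⟨x, hX x List.mem_cons_self, by simp⟩
    | @cons_cons v u x _ ih =>
      refine Path.cons (u := [x]) (v := [x]) (q := 0) ?_
        (ih fun y hy => hX y (List.mem_cons_of_mem _ hy))
      exact List.mem_flatMap.2 ⟨x, hX x List.mem_cons_self, by simp⟩

end Transducer

/-! ### Tests on rational images of languages in the class -/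

namespace LanguageClass

variable {C D : LanguageClass}

theorem parikhAutomaton_computable (hCD : ParikhEquivalentsComputable C D)
    (hDD : D.DownwardClosuresComputable) :
    ∃ f : ℕ →. FiniteAutomaton, Partrec f ∧ ∀ c ∈ C.reps, ∃ A ∈ f c, A.WellFormed ∧
      ∃ K, ParikhEquivalent (C.lang c) K ∧ A.accepts = downwardClosure K := by
  obtain ⟨f, hf, hf'⟩ := hCD
  obtain ⟨g, hg, hg'⟩ := hDD
  refine ⟨fun c => (f c).bind g, hf.bind (hg.comp Computable.snd), fun c hc => ?_⟩
  obtain ⟨d, hd, hdr, hp⟩ := hf' c hc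
  obtain ⟨A, hA, hw, ha⟩ := hg' d hdr
  exact ⟨A, Part.mem_bind hd hA, hw, _, hp, ha⟩

/-- A representation does not reveal an alphabet, but the letters of `L` are those of `K`, and these
occur on the edges of `A`. -/
theorem isOver_of_parikhEquivalent {L K : Language ℕ} (h : ParikhEquivalent L K)
    {A : FiniteAutomaton} (hw : A.WellFormed) (hA : A.accepts = downwardClosure K) :
    IsOver L A.alphabet := by
  intro w hwL x hx
  obtain ⟨v, hv, hc⟩ := h.exists_count_eq hwL
  have hxv : x ∈ v := by
    rw [← List.count_pos_iff, hc]
    exact List.count_pos_iff.2 hx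
  have hvA : v ∈ A.accepts := hA ▸ subset_downwardClosure hv
  obtain ⟨q, -, hp⟩ := hvA
  have := FiniteAutomaton.Path.invariant (I := fun _ w => ∀ x ∈ w, x ∈ A.alphabet)
    (fun p w u q hw' he x hx => (List.mem_append.1 hx).elim (hw' x) (hw p u q he x)) hp []
    (by simp)
  exact this x hxv

/-- From a representation of `L`, one can compute an alphabet of `L` and a representation of
the downward closure of `L`. -/
theorem downwardClosureRep_computable (hC : C.IsFullTrio)
    (hCD : ParikhEquivalentsComputable C D) (hDD : D.DownwardClosuresComputable) :
    ∃ f : ℕ →. ℕ × List ℕ, Partrec f ∧ ∀ c ∈ C.reps, ∃ t ∈ f c, t.1 ∈ C.reps ∧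
      C.lang t.1 = downwardClosure (C.lang c) ∧ IsOver (C.lang t.1) t.2 := by
  obtain ⟨g, hg, hg'⟩ := parikhAutomaton_computable hCD hDD
  obtain ⟨f, hf, hf'⟩ := hC
  refine ⟨fun c => (g c).bind fun A =>
    (f (c, Transducer.subword A.alphabet)).map fun d => (d, A.alphabet), ?_, ?_⟩
  · refine hg.bind (Partrec.map (hf.comp ?_) ?_)
    · exact Computable.pair Computable.fst (Transducer.primrec_subword.to_comp.comp
        (FiniteAutomaton.primrec_alphabet.to_comp.comp Computable.snd))
    · exact Computable.pair Computable.snd (FiniteAutomaton.primrec_alphabet.to_comp.comp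
        (Computable.snd.comp Computable.fst))
  · intro c hc
    obtain ⟨A, hA, hw, K, hK, hAK⟩ := hg' c hc
    have hX := isOver_of_parikhEquivalent hK hw hAK
    obtain ⟨d, hd, hdr, hdl⟩ := hf' c hc (Transducer.subword A.alphabet)
      Transducer.wellFormed_ofEdges (Transducer.isOver_ofEdges hX)
    rw [Transducer.apply_subword hX] at hdl
    refine ⟨(d, A.alphabet), Part.mem_bind hA (Part.mem_map _ hd), hdr, hdl, ?_⟩
    rintro w hw' x hx
    rw [hdl] at hw'
    obtain ⟨v, hv, hwv⟩ := hw'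
    exact hX v hv x (hwv.subset hx)

/-- Emptiness and simultaneous unboundedness depend only on the Parikh image and are unaffected by
downward closure, so they can be read off an automaton obtained through `D`. `E` and `U` are defined
on all inputs, but are meaningful only for valid representations and suitable transducers. -/
theorem semiDec_apply (hC : C.IsFullTrio)
    (hCD : ParikhEquivalentsComputable C D) (hDD : D.DownwardClosuresComputable) :
    ∃ E : ℕ × Transducer → Prop, ∃ U : (ℕ × Transducer) × List ℕ → Prop, SemiDec E ∧ SemiDec U ∧
      ∀ c ∈ C.reps, ∀ T : Transducer, T.WellFormed → IsOver (C.lang c) T.input →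
        (E (c, T) ↔ ∀ w, w ∉ T.apply (C.lang c)) ∧
        ∀ l, U ((c, T), l) ↔ SimultaneouslyUnbounded (T.apply (C.lang c)) l := by
  obtain ⟨g, hg, hg'⟩ := parikhAutomaton_computable hCD hDD
  obtain ⟨f, hf, hf'⟩ := hC
  have hfg : Partrec fun t : ℕ × Transducer => (f t).bind g :=
    hf.bind (hg.comp Computable.snd)
  have hgraph := SemiDec.graph hfg
  refine ⟨fun t => ∃ A, A ∈ (f t).bind g ∧ ∀ w, w ∉ A.accepts,
    fun t => ∃ A, A ∈ (f t.1).bind g ∧ SimultaneouslyUnbounded A.accepts t.2, ?_, ?_, ?_⟩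
  · exact (hgraph.and (FiniteAutomaton.semiDec_forall_notMem_accepts.comp Primrec.snd)).exists_right
  · exact ((hgraph.comp (Primrec.pair (Primrec.fst.comp Primrec.fst) Primrec.snd)).and
      (FiniteAutomaton.semiDec_simultaneouslyUnbounded.comp
        (Primrec.pair Primrec.snd (Primrec.snd.comp Primrec.fst)))).exists_right
  · intro c hc T hT hX
    obtain ⟨d, hd, hdr, hdl⟩ := hf' c hc T hT hX
    obtain ⟨A, hA, -, K, hK, hAK⟩ := hg' d hdr
    have hmem : A ∈ (f (c, T)).bind g := Part.mem_bind hd hA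
    rw [hdl] at hK
    have h1 : (∀ w, w ∉ A.accepts) ↔ ∀ w, w ∉ T.apply (C.lang c) := by
      rw [hAK, forall_notMem_downwardClosure, hK.forall_notMem_iff]
    have h2 : ∀ l, SimultaneouslyUnbounded A.accepts l ↔
        SimultaneouslyUnbounded (T.apply (C.lang c)) l := by
      intro l
      rw [hAK, simultaneouslyUnbounded_downwardClosure]
      exact ⟨hK.symm.simultaneouslyUnbounded, hK.simultaneouslyUnbounded⟩
    refine ⟨?_, fun l => ?_⟩
    · rw [← h1]
      exact ⟨fun ⟨B, hB, h⟩ => Part.mem_unique hB hmem ▸ h, fun h => ⟨A, hmem, h⟩⟩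
    · rw [← h2]
      exact ⟨fun ⟨B, hB, h⟩ => Part.mem_unique hB hmem ▸ h, fun h => ⟨A, hmem, h⟩⟩

end LanguageClass

/-! ### Tree-shaped candidates and the transducers that test them -/

/-- A block `(u, v)` stands for the words `u vᵏ`. -/
abbrev Block := List ℕ × List ℕ

/-- An expression is a list of blocks; its head is the last block. -/
abbrev Expr := List Block

/-- A node is a nonempty expression, split into its last block and the other ones. -/
abbrev Node := Block × Expr

/-- The expression of a node. -/
def Node.expr (n : Node) : Expr := n.1 :: n.2

/-- The word of an expression, where the block above `i` other blocks is iterated `f i` times. -/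
def unroll (f : ℕ → ℕ) : Expr → List ℕ
  | [] => []
  | b :: t => unroll f t ++ b.1 ++ (List.replicate (f t.length) b.2).flatten

theorem unroll_congr {f g : ℕ → ℕ} {s : Expr} (h : ∀ i < s.length, f i = g i) :
    unroll f s = unroll g s := by
  induction s with
  | nil => rfl
  | cons b t ih =>
    rw [unroll, unroll, ih fun i hi => h i (hi.trans (Nat.lt_succ_self _)),
      h t.length (Nat.lt_succ_self _)]

theorem flatten_replicate_sublist {m n : ℕ} (h : m ≤ n) (u : List ℕ) :
    (List.replicate m u).flatten.Sublist (List.replicate n u).flatten :=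
  ((List.replicate_sublist_replicate u).2 h).flatten

theorem unroll_mono {f g : ℕ → ℕ} {s : Expr} (h : ∀ i < s.length, f i ≤ g i) :
    (unroll f s).Sublist (unroll g s) := by
  induction s with
  | nil => exact List.Sublist.refl _
  | cons b t ih =>
    exact ((ih fun i hi => h i (hi.trans (Nat.lt_succ_self _))).append
      (List.Sublist.refl _)).append (flatten_replicate_sublist (h _ (Nat.lt_succ_self _)) _)

/-- The state that represents an expression. -/
def state (s : Expr) : ℕ := Encodable.encode s + 1

theorem state_injective : Function.Injective state :=
  fun _ _ h => Encodable.encode_injective (Nat.succ_injective h)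

/-- This leaves 0 free as the final state of `reader`. -/
theorem state_ne_zero (s : Expr) : state s ≠ 0 := Nat.succ_ne_zero _

/-- The edges of a node: one that reads the first component of its last block, and loops that
read the letters of the second one. -/
def nodeEdges (n : Node) : List (ℕ × List ℕ × ℕ) :=
  (state n.2, n.1.1, state n.expr) :: n.1.2.map fun y => (state n.expr, [y], state n.expr)

/-- The automaton whose states are the nodes in `H`, and whose final states are all nodes. -/
def treeAutomaton (H : List Node) : FiniteAutomaton :=
  ⟨(H.flatMap nodeEdges).flatMap fun e => e.2.1, H.flatMap nodeEdges, state [],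
    H.map fun n => state n.expr⟩

theorem mem_treeAutomaton_edges {H : List Node} {p q : ℕ} {u : List ℕ} :
    (p, u, q) ∈ (treeAutomaton H).edges ↔ ∃ n ∈ H,
      (p = state n.2 ∧ u = n.1.1 ∧ q = state n.expr) ∨
      ∃ y ∈ n.1.2, p = state n.expr ∧ u = [y] ∧ q = state n.expr := by
  simp only [treeAutomaton, List.mem_flatMap, nodeEdges, List.mem_cons, List.mem_map,
    Prod.mk.injEq, eq_comm]

theorem wellFormed_treeAutomaton (H : List Node) : (treeAutomaton H).WellFormed :=
  fun _ _ _ he _ hx => List.mem_flatMap.2 ⟨_, he, hx⟩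

/-- A transducer that accepts the words `w ++ x` such that `w` leads to the state `q` of
`treeAutomaton H`. -/
def reader (X : List ℕ) (H : List Node) (q : ℕ) (x : List ℕ) : Transducer :=
  .ofEdges X ((treeAutomaton H).edges.map (fun e => (e.1, e.2.1, [], e.2.2)) ++ [(q, x, [], 0)])
    (state []) [0]

theorem notMem_apply_reader {M : Language ℕ} {X : List ℕ} {H : List Node} {q : ℕ} (hq : q ≠ 0)
    {x : List ℕ} : (∀ v, v ∉ (reader X H q x).apply M) ↔
      ∀ w, (treeAutomaton H).Path (state []) w q → w ++ x ∉ M := by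
  have hE : ∀ p u v r, (p, u, v, r) ∈ (reader X H q x).edges ↔
      ((p, u, r) ∈ (treeAutomaton H).edges ∧ v = []) ∨ (p = q ∧ u = x ∧ v = [] ∧ r = 0) := by
    intro p u v r
    simp only [reader, Transducer.ofEdges, List.mem_append, List.mem_map, List.mem_singleton,
      Prod.mk.injEq, Prod.exists]
    constructor
    · rintro (⟨_, _, _, h, rfl, rfl, rfl, rfl⟩ | h)
      · exact Or.inl ⟨h, rfl⟩
      · exact Or.inr h
    · rintro (⟨h, rfl⟩ | h)
      · exact Or.inl ⟨_, _, _, h, rfl, rfl, rfl, rfl⟩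
      · exact Or.inr h
  constructor
  · intro h w hw hM
    refine h [] ⟨w ++ x, hM, 0, by simp [reader, Transducer.ofEdges], ?_⟩
    have h1 : ∀ {p r : ℕ} {u : List ℕ}, (treeAutomaton H).Path p u r →
        (reader X H q x).Path p u [] r := by
      intro p r u hp
      induction hp with
      | nil r => exact .nil r
      | cons e _ ih => exact .cons (v := []) ((hE _ _ _ _).2 (Or.inl ⟨e, rfl⟩)) ih
    exact (h1 hw).snoc (v' := []) ((hE _ _ _ _).2 (Or.inr ⟨rfl, rfl, rfl, rfl⟩))
  · rintro h v ⟨u, hu, r, hr, hp⟩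
    obtain rfl : r = 0 := by simpa [reader, Transducer.ofEdges] using hr
    have := Transducer.Path.invariant (I := fun p u _ =>
      (p ≠ 0 ∧ (treeAutomaton H).Path (state []) u p) ∨
      (p = 0 ∧ ∃ w, (treeAutomaton H).Path (state []) w q ∧ u = w ++ x)) ?_ hp [] []
      (Or.inl ⟨state_ne_zero _, .nil _⟩)
    · obtain ⟨h1, -⟩ | ⟨-, w, hw, h2⟩ := this
      · exact h1 rfl
      · refine h w hw ?_
        rw [← h2]
        exact hu
    · intro p u v u' v' r hI he
      rcases (hE _ _ _ _).1 he with ⟨he, -⟩ | ⟨rfl, rfl, -, rfl⟩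
      · have hpr : p ≠ 0 ∧ r ≠ 0 := by
          obtain ⟨n, -, ⟨rfl, -, rfl⟩ | ⟨y, -, rfl, -, rfl⟩⟩ := mem_treeAutomaton_edges.1 he <;>
            exact ⟨state_ne_zero _, state_ne_zero _⟩
        exact Or.inl ⟨hpr.2, (hI.resolve_right fun h => hpr.1 h.1).2.snoc he⟩
      · exact Or.inr ⟨rfl, u, (hI.resolve_right fun h => hq h.1).2, rfl⟩

/-- The edges of a transducer that counts the iterations of the blocks of a node. -/
def pumpEdges (n : Node) : List (ℕ × List ℕ × List ℕ × ℕ) :=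
  [(state n.2, n.1.1, [], state n.expr), (state n.expr, n.1.2, [n.2.length], state n.expr)]

/-- A transducer that reads the words of the expression of `n` and counts the iterations of
the blocks. -/
def pumper (X : List ℕ) (H : List Node) (n : Node) : Transducer :=
  .ofEdges X (H.flatMap pumpEdges) (state []) [state n.expr]

theorem mem_pumper_edges {X : List ℕ} {H : List Node} {n : Node} {p q : ℕ} {u v : List ℕ} :
    (p, u, v, q) ∈ (pumper X H n).edges ↔ ∃ m ∈ H,
      (p = state m.2 ∧ u = m.1.1 ∧ v = [] ∧ q = state m.expr) ∨
      (p = state m.expr ∧ u = m.1.2 ∧ v = [m.2.length] ∧ q = state m.expr) := by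
  simp only [pumper, Transducer.ofEdges, List.mem_flatMap, pumpEdges, List.mem_cons,
    Prod.mk.injEq, List.not_mem_nil, or_false]

/-- A state encodes the whole expression on the branch to it, so the word read is determined by the
state and the number of iterations of each block. -/
theorem unroll_of_mem_apply_pumper {M : Language ℕ} {X : List ℕ} {H : List Node} {n : Node}
    {v : List ℕ} (h : v ∈ (pumper X H n).apply M) : unroll (fun i => v.count i) n.expr ∈ M := by
  obtain ⟨u, hu, r, hr, hp⟩ := h
  obtain rfl : r = state n.expr := by simpa [pumper, Transducer.ofEdges] using hr
  -- The bound on the letters of `v` ensures that a newly entered block starts with count zero.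
  have := Transducer.Path.invariant (I := fun p u v => ∃ s, p = state s ∧
    u = unroll (fun i => v.count i) s ∧ ∀ i ∈ v, i < s.length) ?_ hp [] []
    ⟨[], rfl, rfl, by simp⟩
  · obtain ⟨s, h1, h2, -⟩ := this
    rw [state_injective h1]
    simp only [List.nil_append] at h2
    rw [← h2]
    exact hu
  · rintro p u v u' v' q ⟨s, hps, rfl, hv⟩ he
    obtain ⟨m, -, ⟨hpm, rfl, rfl, rfl⟩ | ⟨hpm, rfl, rfl, rfl⟩⟩ := mem_pumper_edges.1 he
    · rw [hps] at hpm
      obtain rfl := state_injective hpm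
      refine ⟨m.expr, rfl, ?_, fun i hi => ?_⟩
      · have : v.count m.2.length = 0 :=
          List.count_eq_zero_of_not_mem fun h => lt_irrefl _ (hv _ h)
        simp [Node.expr, unroll, this]
      · rw [List.append_nil] at hi
        exact (hv i hi).trans (Nat.lt_succ_self _)
    · rw [hps] at hpm
      obtain rfl := state_injective hpm
      refine ⟨m.expr, rfl, ?_, fun i hi => ?_⟩
      · have h1 : unroll (fun i => (v ++ [m.2.length]).count i) m.2 =
            unroll (fun i => v.count i) m.2 := by
          refine unroll_congr fun i hi => ?_
          rw [List.count_append, List.count_eq_zero_of_not_mem (l := [m.2.length]), Nat.add_zero]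
          simpa using hi.ne
        simp only [Node.expr, unroll, h1]
        simp [List.replicate_succ']
      · rcases List.mem_append.1 hi with hi | hi
        · exact hv i hi
        · rw [List.mem_singleton.1 hi]
          exact Nat.lt_succ_self _

/-! ### Soundness of the conditions on a candidate -/

/-- The conditions under which `treeAutomaton H` accepts `M ⊆ X*`. -/
structure IsTree (M : Language ℕ) (X : List ℕ) (H : List Node) : Prop where
  root : (∃ n ∈ H, n.2 = [] ∧ n.1.1 = []) ∨ ∀ v, v ∉ (reader X H (state []) []).apply M
  edge : ∀ n ∈ H, ∀ x ∈ X,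
    (∃ e ∈ (treeAutomaton H).edges, e.1 = state n.expr ∧ e.2.1 = [x]) ∨
      ∀ v, v ∉ (reader X H (state n.expr) [x]).apply M
  pump : ∀ n ∈ H,
    SimultaneouslyUnbounded ((pumper X H n).apply M) (List.range (n.2.length + 1))

/-- Accepted words are subwords of unrolled expressions, and `pump` puts large enough unrollings
into `M`. Conversely, a word in `M` is followed letter by letter: its prefixes are in `M`, so `edge`
cannot fail for lack of an edge. -/
theorem IsTree.accepts_eq {M : Language ℕ} {X : List ℕ} {H : List Node} (h : IsTree M X H)
    (hX : IsOver M X) (hM : ∀ u v, u.Sublist v → v ∈ M → u ∈ M) :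
    (treeAutomaton H).accepts = M := by
  ext w
  constructor
  · rintro ⟨q, hq, hp⟩
    simp only [treeAutomaton, List.mem_map] at hq
    obtain ⟨n, hn, rfl⟩ := hq
    have := FiniteAutomaton.Path.invariant (I := fun p w =>
      ∃ s k, p = state s ∧ w.Sublist (unroll (fun _ => k) s)) ?_ hp []
      ⟨[], 0, rfl, List.nil_sublist _⟩
    · obtain ⟨s, k, h1, h2⟩ := this
      obtain rfl := state_injective h1
      obtain ⟨v, hv, hc⟩ := h.pump n hn k
      refine hM _ _ (h2.trans (unroll_mono fun i hi => hc i (List.mem_range.2 hi)))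
        (unroll_of_mem_apply_pumper hv)
    · rintro p w u q ⟨s, k, hps, hw⟩ he
      obtain ⟨m, -, ⟨hpm, rfl, rfl⟩ | ⟨y, hy, hpm, rfl, rfl⟩⟩ := mem_treeAutomaton_edges.1 he
      · rw [hps] at hpm
        obtain rfl := state_injective hpm
        exact ⟨m.expr, k, rfl, (hw.append (List.Sublist.refl _)).trans
          (List.sublist_append_left _ _)⟩
      · rw [hps] at hpm
        obtain rfl := state_injective hpm
        -- The loop letter `y` embeds into one additional copy of the word `m.1.2`; the other blocks
        -- only grow.
        refine ⟨m.expr, k + 1, rfl, ?_⟩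
        have h1 := (hw.append (List.singleton_sublist.2 hy))
        refine h1.trans ?_
        simp only [Node.expr, unroll, List.replicate_succ', List.flatten_append,
          List.flatten_singleton]
        rw [← List.append_assoc]
        exact (((unroll_mono fun _ _ => Nat.le_succ k).append (List.Sublist.refl _)).append
          (List.Sublist.refl _)).append (List.Sublist.refl _)
  · intro hw
    suffices ∃ n ∈ H, (treeAutomaton H).Path (state []) w (state n.expr) by
      obtain ⟨n, hn, hp⟩ := this
      exact ⟨_, List.mem_map.2 ⟨n, hn, rfl⟩, hp⟩
    induction w using List.reverseRecOn with
    | nil =>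
      rcases h.root with ⟨n, hn, h1, h2⟩ | h1
      · refine ⟨n, hn, .cons (u := []) (mem_treeAutomaton_edges.2 ⟨n, hn, Or.inl ?_⟩) (.nil _)⟩
        rw [h1, h2]
        exact ⟨rfl, rfl, rfl⟩
      · exact absurd hw ((notMem_apply_reader (state_ne_zero _)).1 h1 [] (.nil _))
    | append_singleton w x ih =>
      obtain ⟨n, hn, hp⟩ := ih (hM _ _ (List.sublist_append_left _ _) hw)
      rcases h.edge n hn x (hX _ hw x (by simp)) with ⟨⟨p, u, q⟩, he, h1, h2⟩ | h1
      · simp only at h1 h2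
        subst h1 h2
        obtain ⟨m, hm, ⟨-, -, rfl⟩ | ⟨y, -, -, -, rfl⟩⟩ := mem_treeAutomaton_edges.1 he <;>
          exact ⟨m, hm, hp.snoc he⟩
      · exact absurd hw ((notMem_apply_reader (state_ne_zero _)).1 h1 w hp)

/-! ### Existence of a correct candidate -/

/-- The words that lead from the reversed word `r` into `M`. -/
def quotient (M : Language ℕ) (r : List ℕ) : Set (List ℕ) := {v | r.reverse ++ v ∈ M}

theorem mem_quotient_cons {M : Language ℕ} {r v : List ℕ} {x : ℕ} :
    v ∈ quotient M (x :: r) ↔ x :: v ∈ quotient M r := by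
  simp [quotient]

/-- Higman's lemma for words over a finite alphabet. -/
theorem exists_sublist_of_forall_mem (X : List ℕ) (w : ℕ → List ℕ)
    (hw : ∀ n, ∀ x ∈ w n, x ∈ X) : ∃ i j, i < j ∧ (w i).Sublist (w j) := by
  have h1 : {x | x ∈ X}.PartiallyWellOrderedOn (Eq : ℕ → ℕ → Prop) :=
    X.finite_toSet.partiallyWellOrderedOn
  obtain ⟨i, j, hij, h⟩ := (h1.partiallyWellOrderedOn_sublistForall₂ Eq).exists_lt hw
  obtain ⟨l, hl, hs⟩ := List.sublistForall₂_iff.1 h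
  rw [List.forall₂_eq_eq_eq] at hl
  exact ⟨i, j, hij, hl ▸ hs⟩

section Existence

variable {M : Language ℕ} {X : List ℕ}

/-- In a strictly descending chain choose `w n` in the `n`-th quotient but not in the next. Higman
gives `w i` as a subword of `w j` with `i < j`; then `w j`, hence `w i`, lies in quotient `i + 1`, a
contradiction. -/
theorem quotient_wellFounded (hX : IsOver M X) (hM : ∀ u v, u.Sublist v → v ∈ M → u ∈ M) :
    WellFounded fun s r => quotient M s ⊂ quotient M r := by
  rw [wellFounded_iff_isEmpty_descending_chain]
  refine ⟨fun ⟨f, hf⟩ => ?_⟩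
  choose w hw hw' using fun n => Set.exists_of_ssubset (hf n)
  obtain ⟨i, j, hij, h⟩ := exists_sublist_of_forall_mem X w fun n x hx =>
    hX _ (hw n) x (List.mem_append_right _ hx)
  have hanti : Antitone fun n => quotient M (f n) := antitone_nat_of_succ_le fun n => (hf n).1
  have h1 : w j ∈ quotient M (f (i + 1)) := hanti hij (hw j)
  exact hw' i (hM _ _ ((List.Sublist.refl _).append h) h1)

theorem quotient_cons_subset (hM : ∀ u v, u.Sublist v → v ∈ M → u ∈ M) (x : ℕ) (r : List ℕ) :
    quotient M (x :: r) ⊆ quotient M r := by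
  intro v hv
  rw [mem_quotient_cons] at hv
  exact hM _ _ ((List.Sublist.refl _).append (List.sublist_cons_self x v)) hv

variable (M X)

open Classical in
/-- The letters of `X` that do not change the quotient by `r`. -/
noncomputable def loops (r : List ℕ) : List ℕ :=
  X.filter fun x => quotient M (x :: r) = quotient M r

/-- The node that the reversed word `r` leads to. -/
noncomputable def wordNode : List ℕ → Node
  | [] => (([], loops M X []), [])
  | x :: r => (([x], loops M X (x :: r)), (wordNode r).expr)

/-- `s` extends `r` by one letter, stays in `M`, and has a smaller quotient. -/
def Step (r s : List ℕ) : Prop :=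
  ∃ x ∈ X, s = x :: r ∧ x ∉ loops M X r ∧ s.reverse ∈ M

variable {M X}

theorem mem_loops {r : List ℕ} {x : ℕ} :
    x ∈ loops M X r ↔ x ∈ X ∧ quotient M (x :: r) = quotient M r := by
  simp [loops]

theorem wordNode_block_snd (r : List ℕ) : (wordNode M X r).1.2 = loops M X r := by
  cases r <;> rfl

/-- Each step shrinks the quotient strictly and there are finitely many letters to choose from:
well-founded induction with finite branching. -/
theorem finite_reachable (hX : IsOver M X) (hM : ∀ u v, u.Sublist v → v ∈ M → u ∈ M)
    (r : List ℕ) : {s | Relation.ReflTransGen (Step M X) r s}.Finite := by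
  induction r using (quotient_wellFounded hX hM).induction with
  | _ r ih =>
    have h1 : (⋃ x ∈ {x | x ∈ X ∧ x ∉ loops M X r},
        {s | Relation.ReflTransGen (Step M X) (x :: r) s}).Finite := by
      refine Set.Finite.biUnion (X.finite_toSet.subset fun x hx => hx.1) fun x hx => ih _ ?_
      refine (quotient_cons_subset hM x r).ssubset_of_ne fun h => hx.2 ?_
      exact mem_loops.2 ⟨hx.1, h⟩
    refine (h1.insert r).subset fun s hs => ?_
    rcases Relation.ReflTransGen.cases_head hs with rfl | ⟨t, ⟨x, hx, rfl, hl, -⟩, hs⟩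
    · exact Set.mem_insert _ _
    · exact Set.mem_insert_of_mem _ (Set.mem_biUnion (show x ∈ {x | x ∈ X ∧ _} from ⟨hx, hl⟩) hs)

theorem wordNode_expr_injective : Function.Injective fun r => (wordNode M X r).expr := by
  intro r
  induction r with
  | nil =>
    intro s h
    cases s with
    | nil => rfl
    | cons y s => simp [wordNode, Node.expr] at h
  | cons x r ih =>
    intro s h
    cases s with
    | nil => simp [wordNode, Node.expr] at h
    | cons y s =>
      simp only [wordNode, Node.expr, List.cons.injEq, Prod.mk.injEq, and_true] at h
      obtain ⟨⟨rfl, -⟩, h⟩ := h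
      rw [ih (a₂ := s) (by simpa [Node.expr] using h)]

theorem wordNode_length (r : List ℕ) : (wordNode M X r).expr.length = r.length + 1 := by
  induction r with
  | nil => rfl
  | cons x r ih => simp [wordNode, Node.expr] at ih ⊢; exact ih

theorem flatten_replicate_loops_append {r v : List ℕ} (h : v ∈ quotient M r) (k : ℕ) :
    (List.replicate k (loops M X r)).flatten ++ v ∈ quotient M r := by
  have h1 : ∀ y : List ℕ, (∀ x ∈ y, x ∈ loops M X r) → y ++ v ∈ quotient M r := by
    intro y hy
    induction y with
    | nil => exact h
    | cons x y ih =>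
      have hx := (mem_loops.1 (hy x List.mem_cons_self)).2
      rw [List.cons_append, ← mem_quotient_cons, hx]
      exact ih fun z hz => hy z (List.mem_cons_of_mem _ hz)
  refine h1 _ fun x hx => ?_
  obtain ⟨l, hl, hx⟩ := List.mem_flatten.1 hx
  rw [List.eq_of_mem_replicate hl] at hx
  exact hx

/-- Loop letters do not change the quotient, so they can be inserted behind each letter of `r`
without leaving `M`. -/
theorem unroll_wordNode_append {r v : List ℕ} (h : v ∈ quotient M r) (k : ℕ) :
    unroll (fun _ => k) (wordNode M X r).expr ++ v ∈ M := by
  induction r generalizing v with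
  | nil =>
    have := flatten_replicate_loops_append (X := X) h k
    simpa [wordNode, Node.expr, unroll, quotient] using this
  | cons x r ih =>
    have h1 := flatten_replicate_loops_append (X := X) h k
    rw [mem_quotient_cons] at h1
    have h2 := ih h1
    simpa [wordNode, Node.expr, unroll] using h2

theorem exists_pumper_path {H : List Node} {n : Node} {r : List ℕ}
    (hr : ∀ s, s <:+ r → wordNode M X s ∈ H) (k : ℕ) :
    ∃ v, (pumper X H n).Path (state []) (unroll (fun _ => k) (wordNode M X r).expr) v
      (state (wordNode M X r).expr) ∧ ∀ i < r.length + 1, k ≤ v.count i := by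
  have tail : ∀ m ∈ H, ∀ u v, (pumper X H n).Path (state []) u v (state m.2) →
      ∃ v', (pumper X H n).Path (state [])
        (u ++ m.1.1 ++ (List.replicate k m.1.2).flatten) (v ++ v') (state m.expr) ∧
        k ≤ v'.count m.2.length := by
    intro m hm u v hp
    refine ⟨List.replicate k m.2.length, ?_, by simp⟩
    induction k with
    | zero =>
      have := hp.snoc (mem_pumper_edges.2 ⟨m, hm, Or.inl ⟨rfl, rfl, rfl, rfl⟩⟩)
      simpa using this
    | succ k ih =>
      have := ih.snoc (mem_pumper_edges.2 ⟨m, hm, Or.inr ⟨rfl, rfl, rfl, rfl⟩⟩)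
      simpa [List.replicate_succ'] using this
  induction r with
  | nil =>
    obtain ⟨v, h1, h2⟩ := tail _ (hr [] List.suffix_rfl) [] [] (.nil _)
    refine ⟨v, by simpa [wordNode, Node.expr, unroll] using h1, fun i hi => ?_⟩
    obtain rfl : i = 0 := by simpa using hi
    exact h2
  | cons x r ih =>
    obtain ⟨v, h1, h2⟩ := ih fun s hs => hr s (hs.trans (List.suffix_cons x r))
    obtain ⟨v', h3, h4⟩ := tail _ (hr (x :: r) List.suffix_rfl) _ _ h1
    refine ⟨v ++ v', h3, fun i hi => ?_⟩
    rw [List.count_append]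
    rcases Nat.lt_succ_iff_lt_or_eq.1 hi with hi | rfl
    · exact (h2 i hi).trans (Nat.le_add_right _ _)
    · have : (wordNode M X (x :: r)).2.length = (x :: r).length := by
        simpa [wordNode] using wordNode_length (M := M) (X := X) r
      rw [this] at h4
      exact h4.trans (Nat.le_add_left _ _)

theorem exists_isTree (hX : IsOver M X) (hM : ∀ u v, u.Sublist v → v ∈ M → u ∈ M) :
    ∃ H, IsTree M X H := by
  by_cases hne : [] ∈ M
  swap
  -- A downward closed language without the empty word is empty, and the empty tree fits it.
  · have he : ∀ w, w ∉ M := fun w hw => hne (hM _ _ (List.nil_sublist w) hw)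
    exact ⟨[], Or.inr fun v ⟨u, hu, _⟩ => he u hu, by simp, by simp⟩
  let S := {s | Relation.ReflTransGen (Step M X) [] s}
  have hS : S.Finite := finite_reachable hX hM []
  have hSM : ∀ r ∈ S, r.reverse ∈ M := by
    intro r hr
    rcases Relation.ReflTransGen.cases_tail hr with rfl | ⟨s, -, x, -, rfl, -, h⟩
    · exact hne
    · exact h
  have hsuf : ∀ r ∈ S, ∀ s, s <:+ r → s ∈ S := by
    intro r hr
    induction hr with
    | refl =>
      intro s hs
      rw [List.suffix_nil.1 hs]
      exact .refl
    | @tail b c hb hc ih =>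
      intro s hs
      obtain ⟨x, -, rfl, -⟩ := id hc
      rcases List.suffix_cons_iff.1 hs with rfl | hs
      · exact hb.tail hc
      · exact ih s hs
  have hH : ∀ n, n ∈ hS.toFinset.toList.map (wordNode M X) ↔ ∃ r ∈ S, wordNode M X r = n := by
    simp
  generalize hS.toFinset.toList.map (wordNode M X) = H at hH
  -- A word `w` that reaches the node of `r` has the same quotient as `r`: tree edges append the
  -- same letter to both, and loops preserve the quotient. Hence testing the extension of `r` by a
  -- letter tests all such `w`.
  have hpath : ∀ w p, (treeAutomaton H).Path (state []) w p →
      (p = state [] ∧ w = []) ∨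
      ∃ r, p = state (wordNode M X r).expr ∧ ∀ v, w ++ v ∈ M ↔ r.reverse ++ v ∈ M := by
    intro w p hp
    refine FiniteAutomaton.Path.invariant (I := fun p w => (p = state [] ∧ w = []) ∨
      ∃ r, p = state (wordNode M X r).expr ∧ ∀ v, w ++ v ∈ M ↔ r.reverse ++ v ∈ M) ?_ hp []
      (Or.inl ⟨rfl, rfl⟩)
    intro p w u q hI he
    obtain ⟨n, hn, he⟩ := mem_treeAutomaton_edges.1 he
    obtain ⟨r, -, rfl⟩ := (hH n).1 hn
    right
    rcases he with ⟨hp, rfl, rfl⟩ | ⟨y, hy, hp, rfl, rfl⟩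
    · cases r with
      | nil =>
        refine ⟨[], rfl, ?_⟩
        rcases hI with ⟨-, rfl⟩ | ⟨r, hr, -⟩
        · simp [wordNode]
        · rw [hp] at hr
          have := state_injective hr
          simp [wordNode, Node.expr] at this
      | cons x r =>
        refine ⟨x :: r, rfl, ?_⟩
        rcases hI with ⟨hr, -⟩ | ⟨r', hr', h⟩
        · rw [hp] at hr
          have := state_injective hr
          simp [wordNode, Node.expr] at this
        · rw [hp] at hr'
          obtain rfl := wordNode_expr_injective (state_injective hr')
          intro v
          simpa [wordNode] using h (x :: v)
    · rw [wordNode_block_snd] at hy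
      refine ⟨r, rfl, ?_⟩
      rcases hI with ⟨hr, -⟩ | ⟨r', hr', h⟩
      · rw [hp] at hr
        have := state_injective hr
        simp [Node.expr] at this
      · rw [hp] at hr'
        obtain rfl := wordNode_expr_injective (state_injective hr')
        intro v
        rw [List.append_assoc, h]
        have := Set.ext_iff.1 (mem_loops.1 hy).2 v
        rw [mem_quotient_cons] at this
        exact this
  refine ⟨H, ⟨?_, ?_, ?_⟩⟩
  · exact Or.inl ⟨_, (hH _).2 ⟨[], .refl, rfl⟩, rfl, rfl⟩
  · intro n hn x hx
    obtain ⟨r, hr, rfl⟩ := (hH n).1 hn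
    by_cases hl : x ∈ loops M X r
    · exact Or.inl ⟨_, mem_treeAutomaton_edges.2 ⟨_, hn, Or.inr ⟨x, by rwa [wordNode_block_snd],
        rfl, rfl, rfl⟩⟩, rfl, rfl⟩
    by_cases hxr : (x :: r).reverse ∈ M
    · have hxS : x :: r ∈ S := Relation.ReflTransGen.tail hr ⟨x, hx, rfl, hl, hxr⟩
      exact Or.inl ⟨_, mem_treeAutomaton_edges.2 ⟨_, (hH _).2 ⟨_, hxS, rfl⟩,
        Or.inl ⟨rfl, rfl, rfl⟩⟩, rfl, rfl⟩
    · refine Or.inr ((notMem_apply_reader (state_ne_zero _)).2 fun w hw hwx => ?_)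
      rcases hpath _ _ hw with ⟨h, -⟩ | ⟨r', hr', h⟩
      · have := state_injective h
        simp [Node.expr] at this
      · obtain rfl := wordNode_expr_injective (state_injective hr')
        rw [h] at hwx
        exact hxr (by simpa using hwx)
  · intro n hn k
    obtain ⟨r, hr, rfl⟩ := (hH n).1 hn
    obtain ⟨v, hv, hc⟩ := exists_pumper_path (n := wordNode M X r) (k := k) (r := r)
      fun s hs => (hH _).2 ⟨s, hsuf r hr s hs, rfl⟩
    refine ⟨v, ⟨_, ?_, state (wordNode M X r).expr, ?_, hv⟩, fun i hi => hc i ?_⟩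
    · have : [] ∈ quotient M r := by simpa [quotient] using hSM r hr
      have h := unroll_wordNode_append (X := X) this k
      rwa [List.append_nil] at h
    · simp [pumper, Transducer.ofEdges]
    · have := wordNode_length (M := M) (X := X) r
      rw [List.mem_range] at hi
      simp only [Node.expr, List.length_cons] at this
      omega

end Existence

/-! ### Computability of the search -/

section Primrec

variable {α : Type*} [Primcodable α]

theorem primrec_state : Primrec state := Primrec.succ.comp Primrec.encode

theorem primrec_nodeExpr : Primrec Node.expr := Primrec.list_cons.comp Primrec.fst Primrec.snd

theorem primrec_singleton : Primrec fun a : α => [a] :=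
  Primrec.list_cons.comp Primrec.id (Primrec.const [])

theorem primrec_nodeEdges : Primrec nodeEdges := by
  have he : Primrec fun n : Node => state n.expr := primrec_state.comp primrec_nodeExpr
  refine Primrec.list_cons.comp ?_ (Primrec.list_map (Primrec.snd.comp Primrec.fst) ?_)
  · exact Primrec.pair (primrec_state.comp Primrec.snd)
      (Primrec.pair (Primrec.fst.comp Primrec.fst) he)
  · exact Primrec.pair (he.comp Primrec.fst) (Primrec.pair (primrec_singleton.comp Primrec.snd)
      (he.comp Primrec.fst))

theorem primrec_treeAutomaton : Primrec treeAutomaton := by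
  have h1 : Primrec fun H : List Node => H.flatMap nodeEdges :=
    Primrec.list_flatMap Primrec.id (primrec_nodeEdges.comp Primrec.snd)
  have h2 : Primrec FiniteAutomaton.equivTuple.symm := Primrec.of_equiv_symm
  have h3 : Primrec fun H : List Node => (H.flatMap nodeEdges).flatMap fun e => e.2.1 :=
    Primrec.list_flatMap h1 (Primrec.fst.comp (Primrec.snd.comp Primrec.snd))
  refine h2.comp (Primrec.pair h3 (Primrec.pair h1
    (Primrec.pair (Primrec.const _) (Primrec.list_map Primrec.id ?_))))
  exact primrec_state.comp (primrec_nodeExpr.comp Primrec.snd)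

theorem primrec_reader {X : α → List ℕ} {H : α → List Node} {q : α → ℕ} {x : α → List ℕ}
    (hX : Primrec X) (hH : Primrec H) (hq : Primrec q) (hx : Primrec x) :
    Primrec fun a => reader (X a) (H a) (q a) (x a) := by
  refine Transducer.primrec_ofEdges hX (Primrec.list_append.comp (Primrec.list_map
    (FiniteAutomaton.primrec_edges.comp (primrec_treeAutomaton.comp hH)) ?_)
    (primrec_singleton.comp ?_)) (Primrec.const _) (Primrec.const _)
  · exact Primrec.pair (Primrec.fst.comp Primrec.snd)
      (Primrec.pair (Primrec.fst.comp (Primrec.snd.comp Primrec.snd))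
        (Primrec.pair (Primrec.const []) (Primrec.snd.comp (Primrec.snd.comp Primrec.snd))))
  · exact Primrec.pair hq (Primrec.pair hx (Primrec.const ([], 0)))

theorem primrec_pumpEdges : Primrec pumpEdges := by
  have he : Primrec fun n : Node => state n.expr := primrec_state.comp primrec_nodeExpr
  refine Primrec.list_cons.comp ?_ (primrec_singleton.comp ?_)
  · exact Primrec.pair (primrec_state.comp Primrec.snd)
      (Primrec.pair (Primrec.fst.comp Primrec.fst) (Primrec.pair (Primrec.const []) he))
  · exact Primrec.pair he (Primrec.pair (Primrec.snd.comp Primrec.fst)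
      (Primrec.pair (primrec_singleton.comp (Primrec.list_length.comp Primrec.snd)) he))

theorem primrec_pumper {X : α → List ℕ} {H : α → List Node} {n : α → Node}
    (hX : Primrec X) (hH : Primrec H) (hn : Primrec n) :
    Primrec fun a => pumper (X a) (H a) (n a) :=
  Transducer.primrec_ofEdges hX (Primrec.list_flatMap hH (primrec_pumpEdges.comp Primrec.snd))
    (Primrec.const _) (primrec_singleton.comp (primrec_state.comp (primrec_nodeExpr.comp hn)))

end Primrec

theorem semiDec_isTree {C D : LanguageClass} (hC : C.IsFullTrio)
    (hCD : LanguageClass.ParikhEquivalentsComputable C D) (hDD : D.DownwardClosuresComputable) :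
    ∃ P : (ℕ × List ℕ) × List Node → Prop, SemiDec P ∧ ∀ c ∈ C.reps, ∀ X,
      IsOver (C.lang c) X → ∀ H, P ((c, X), H) ↔ IsTree (C.lang c) X H := by
  obtain ⟨E, U, hE, hU, h⟩ := LanguageClass.semiDec_apply hC hCD hDD
  let R : ((ℕ × List ℕ) × List Node) → Prop := fun t =>
    (∃ n ∈ t.2, n.2 = [] ∧ n.1.1 = []) ∨ E (t.1.1, reader t.1.2 t.2 (state []) [])
  let S : ((ℕ × List ℕ) × List Node) × Node → Prop := fun t => ∀ x ∈ t.1.1.2,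
    (∃ e ∈ (treeAutomaton t.1.2).edges, e.1 = state t.2.expr ∧ e.2.1 = [x]) ∨
      E (t.1.1.1, reader t.1.1.2 t.1.2 (state t.2.expr) [x])
  let V : ((ℕ × List ℕ) × List Node) × Node → Prop := fun t =>
    U ((t.1.1.1, pumper t.1.1.2 t.1.2 t.2), List.range (t.2.2.length + 1))
  have hR : SemiDec R := by
    have hroot : PrimrecPred fun n : Node => n.2 = [] ∧ n.1.1 = [] :=
      (Primrec.eq.comp Primrec.snd (Primrec.const [])).and
        (Primrec.eq.comp (Primrec.fst.comp Primrec.fst) (Primrec.const []))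
    refine (SemiDec.of_primrecPred (hroot.exists_mem_list.comp Primrec.snd)).or (hE.comp ?_)
    exact Primrec.pair (Primrec.fst.comp Primrec.fst) (primrec_reader
      (Primrec.snd.comp Primrec.fst) Primrec.snd (Primrec.const _) (Primrec.const _))
  have hS : SemiDec S := by
    have hedge : PrimrecRel fun (e : ℕ × List ℕ × ℕ) (t : ℕ × List ℕ) => e.1 = t.1 ∧ e.2.1 = t.2 :=
      (Primrec.eq.comp (Primrec.fst.comp Primrec.fst) (Primrec.fst.comp Primrec.snd)).and
        (Primrec.eq.comp (Primrec.fst.comp (Primrec.snd.comp Primrec.fst))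
          (Primrec.snd.comp Primrec.snd))
    have h1 : SemiDec fun t : (((ℕ × List ℕ) × List Node) × Node) × ℕ =>
        (∃ e ∈ (treeAutomaton t.1.1.2).edges, e.1 = state t.1.2.expr ∧ e.2.1 = [t.2]) ∨
        E (t.1.1.1.1, reader t.1.1.1.2 t.1.1.2 (state t.1.2.expr) [t.2]) := by
      have pH : Primrec fun t : (((ℕ × List ℕ) × List Node) × Node) × ℕ => t.1.1.2 :=
        Primrec.snd.comp (Primrec.fst.comp Primrec.fst)
      have pC : Primrec fun t : (((ℕ × List ℕ) × List Node) × Node) × ℕ => t.1.1.1 :=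
        Primrec.fst.comp (Primrec.fst.comp Primrec.fst)
      have pq : Primrec fun t : (((ℕ × List ℕ) × List Node) × Node) × ℕ => state t.1.2.expr :=
        primrec_state.comp (primrec_nodeExpr.comp (Primrec.snd.comp Primrec.fst))
      have px : Primrec fun t : (((ℕ × List ℕ) × List Node) × Node) × ℕ => [t.2] :=
        primrec_singleton.comp Primrec.snd
      refine (SemiDec.of_primrecPred (hedge.exists_mem_list.comp (FiniteAutomaton.primrec_edges.comp
        (primrec_treeAutomaton.comp pH)) (Primrec.pair pq px))).or (hE.comp ?_)
      exact Primrec.pair (Primrec.fst.comp pC) (primrec_reader (Primrec.snd.comp pC) pH pq px)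
    exact h1.forall_mem_right.comp (Primrec.pair Primrec.id
      (Primrec.snd.comp (Primrec.fst.comp Primrec.fst)))
  have hV : SemiDec V := by
    have pC : Primrec fun t : ((ℕ × List ℕ) × List Node) × Node => t.1.1 :=
      Primrec.fst.comp Primrec.fst
    refine hU.comp (Primrec.pair (Primrec.pair (Primrec.fst.comp pC) (primrec_pumper
      (Primrec.snd.comp pC) (Primrec.snd.comp Primrec.fst) Primrec.snd)) ?_)
    exact Primrec.list_range.comp (Primrec.succ.comp (Primrec.list_length.comp
      (Primrec.snd.comp Primrec.snd)))
  refine ⟨fun t => R t ∧ (∀ n ∈ t.2, S (t, n)) ∧ ∀ n ∈ t.2, V (t, n), ?_, ?_⟩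
  · exact hR.and ((hS.forall_mem_right.comp (Primrec.pair Primrec.id Primrec.snd)).and
      (hV.forall_mem_right.comp (Primrec.pair Primrec.id Primrec.snd)))
  · intro c hc X hX H
    have hr : ∀ q x, E (c, reader X H q x) ↔ ∀ v, v ∉ (reader X H q x).apply (C.lang c) :=
      fun q x => (h c hc _ Transducer.wellFormed_ofEdges (Transducer.isOver_ofEdges hX)).1
    have hp : ∀ n l, U ((c, pumper X H n), l) ↔
        SimultaneouslyUnbounded ((pumper X H n).apply (C.lang c)) l :=
      fun n => (h c hc _ Transducer.wellFormed_ofEdges (Transducer.isOver_ofEdges hX)).2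
    simp only [R, S, V, hr, hp]
    exact ⟨fun ⟨h1, h2, h3⟩ => ⟨h1, h2, h3⟩, fun ⟨h1, h2, h3⟩ => ⟨h1, h2, h3⟩⟩

end DClosure

theorem mainTheorem2 (C D : DClosure.LanguageClass)
    (hC : C.IsFullTrio) (hD : D.IsFullTrio)
    (hCD : DClosure.LanguageClass.ParikhEquivalentsComputable C D)
    (hDD : D.DownwardClosuresComputable) :
    C.DownwardClosuresComputable := by
  obtain ⟨f, hf, hf'⟩ := DClosure.LanguageClass.downwardClosureRep_computable hC hCD hDD
  obtain ⟨P, hP, hP'⟩ := DClosure.semiDec_isTree hC hCD hDD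
  obtain ⟨g, hg, hg'⟩ := hP.uniformize
  refine ⟨fun c => (f c).bind fun t => (g t).map DClosure.treeAutomaton, ?_, fun c hc => ?_⟩
  · exact hf.bind (Partrec.map (hg.comp Computable.snd)
      (DClosure.primrec_treeAutomaton.to_comp.comp Computable.snd))
  · obtain ⟨⟨d, X⟩, ht, hd, hdL, hX⟩ := hf' c hc
    have hM : ∀ u v, u.Sublist v → v ∈ C.lang d → u ∈ C.lang d := by
      simp only at hdL
      rw [hdL]
      exact fun u v => DClosure.sublist_closed
    obtain ⟨H, hH⟩ := DClosure.exists_isTree hX hM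
    -- The search may find another tree than `H`, but every tree that passes the test is correct.
    obtain ⟨H', hH', hPH⟩ := hg' (d, X) ⟨H, (hP' d hd X hX H).2 hH⟩
    refine ⟨_, Part.mem_bind ht (Part.mem_map _ hH'), DClosure.wellFormed_treeAutomaton H', ?_⟩
    rw [((hP' d hd X hX H').1 hPH).accepts_eq hX hM]
    exact hdL
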